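/- Throughout, Banach lattices are real. A Banach lattice $X$ has the positive Schur property if every weakly null sequence of positive vectors of $X$ is norm null. A Banach lattice $F$ contains a lattice copy of $\ell_1$ if there is a Riesz homomorphism $T\colon \ell_1\to F$ that is a linear homeomorphism onto its range. Duals carry the dual norm and the dual order ($f\le g$ iff $f(x)\le g(x)$ for all $x\ge 0$), $E$ is identified with its image in $E^{**}$ under the canonical embedding, a closed ideal is a norm closed solid linear subspace, and $E^{**}/E$ carries the quotient norm and the quotient order ($a\le b$ iff $x\le y$ for some $x\in a$, $y\in b$). **Proposition.** Let $E$ be a Banach lattice with the positive Schur property such that $E^*$ contains a lattice copy of $\ell_1$. Then $E$ is a closed ideal of $E^{**}$, and both $E^{**}$ and the quotient Banach lattice $E^{**}/E$ fail the positive Schur property. -/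

import Mathlib

open Filter Topology

namespace BanachLat

/-! ### The order dual of a Banach lattice -/

section Dual

theorem norm_le_of_nonneg_le {E : Type*} [NormedAddCommGroup E] [Lattice E]
    [IsOrderedAddMonoid E] [HasSolidNorm E] {x y : E} (hy : 0 ≤ y) (hyx : y ≤ x) : ‖y‖ ≤ ‖x‖ :=
  norm_le_norm_of_abs_le_abs (by rwa [abs_of_nonneg hy, abs_of_nonneg (hy.trans hyx)])

variable {E : Type*} [NormedAddCommGroup E] [NormedSpace ℝ E] [Lattice E] [IsOrderedAddMonoid E]

/-- The dual order: `f ≤ g` iff `f x ≤ g x` for every `x ≥ 0`. -/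
instance dualPartialOrder : PartialOrder (StrongDual ℝ E) where
  le f g := ∀ x : E, 0 ≤ x → f x ≤ g x
  le_refl f x _ := le_refl (f x)
  le_trans f g h hfg hgh x hx := (hfg x hx).trans (hgh x hx)
  le_antisymm f g hfg hgf := by
    have key : ∀ x : E, 0 ≤ x → f x = g x := fun x hx => le_antisymm (hfg x hx) (hgf x hx)
    ext x
    rw [← posPart_sub_negPart x, map_sub, map_sub, key _ (posPart_nonneg x),
      key _ (negPart_nonneg x)]

theorem dual_le_def {f g : StrongDual ℝ E} : f ≤ g ↔ ∀ x : E, 0 ≤ x → f x ≤ g x := Iff.rfl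

instance dualIsOrderedAddMonoid : IsOrderedAddMonoid (StrongDual ℝ E) where
  add_le_add_left f g hfg h x hx := by
    have := hfg x hx
    simpa using this

instance dualIsOrderedModule : IsOrderedModule ℝ (StrongDual ℝ E) where
  smul_le_smul_of_nonneg_left a ha f g hfg x hx := by
    simpa using mul_le_mul_of_nonneg_left (hfg x hx) ha
  smul_le_smul_of_nonneg_right f hf a b hab x hx := by
    have h0 : 0 ≤ f x := by simpa using hf x hx
    simpa using mul_le_mul_of_nonneg_right hab h0

variable [HasSolidNorm E]

/-- The value `sup {f y : 0 ≤ y ≤ x}` of the positive part of `f` at `x ≥ 0`. -/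
noncomputable def coneSup (f : StrongDual ℝ E) (x : E) : ℝ :=
  sSup (f '' Set.Icc 0 x)

theorem le_norm_of_mem_Icc (f : StrongDual ℝ E) {x y : E} (hy : y ∈ Set.Icc 0 x) :
    f y ≤ ‖f‖ * ‖x‖ :=
  (le_abs_self _).trans ((f.le_opNorm y).trans
    (mul_le_mul_of_nonneg_left (norm_le_of_nonneg_le hy.1 hy.2) (norm_nonneg f)))

theorem coneSup_bddAbove (f : StrongDual ℝ E) (x : E) : BddAbove (f '' Set.Icc 0 x) := by
  refine ⟨‖f‖ * ‖x‖, ?_⟩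
  rintro _ ⟨y, hy, rfl⟩
  exact le_norm_of_mem_Icc f hy

theorem le_coneSup (f : StrongDual ℝ E) {x y : E} (hy : 0 ≤ y) (hyx : y ≤ x) :
    f y ≤ coneSup f x :=
  le_csSup (coneSup_bddAbove f x) ⟨y, ⟨hy, hyx⟩, rfl⟩

theorem coneSup_le (f : StrongDual ℝ E) {x : E} (hx : 0 ≤ x) {c : ℝ}
    (h : ∀ y, 0 ≤ y → y ≤ x → f y ≤ c) : coneSup f x ≤ c := by
  refine csSup_le ⟨f 0, 0, ⟨le_rfl, hx⟩, rfl⟩ ?_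
  rintro _ ⟨y, hy, rfl⟩
  exact h y hy.1 hy.2

theorem coneSup_add (f : StrongDual ℝ E) {a b : E} (ha : 0 ≤ a) (hb : 0 ≤ b) :
    coneSup f (a + b) = coneSup f a + coneSup f b := by
  apply le_antisymm
  · refine coneSup_le f (add_nonneg ha hb) fun y hy hyab => ?_
    have h2 : y - y ⊓ a ≤ b := by
      have : y - b ≤ y ⊓ a :=
        le_inf (sub_le_self y hb) (sub_le_iff_le_add.2 hyab)
      exact sub_le_comm.1 this
    have e : f y = f (y ⊓ a) + f (y - y ⊓ a) := by rw [← map_add]; congr 1; abel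
    rw [e]
    exact add_le_add (le_coneSup f (le_inf hy ha) inf_le_right)
      (le_coneSup f (sub_nonneg.2 inf_le_left) h2)
  · rw [← le_sub_iff_add_le]
    refine coneSup_le f ha fun y hy hya => ?_
    rw [le_sub_comm]
    refine coneSup_le f hb fun z hz hzb => ?_
    rw [le_sub_iff_add_le, ← map_add, add_comm]
    exact le_coneSup f (add_nonneg hy hz) (add_le_add hya hzb)

/-- The additive extension of `coneSup f` from the positive cone to the whole space. -/
noncomputable def dualPosAddHom (f : StrongDual ℝ E) : E →+ ℝ :=
  AddMonoidHom.mk' (fun x => coneSup f x⁺ - coneSup f x⁻) fun x y => by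
    have h : (x + y)⁺ + (x⁻ + y⁻) = (x + y)⁻ + (x⁺ + y⁺) := by
      have h1 := posPart_sub_negPart (x + y)
      have h2 := posPart_sub_negPart x
      have h3 := posPart_sub_negPart y
      rw [← sub_eq_zero]
      calc (x + y)⁺ + (x⁻ + y⁻) - ((x + y)⁻ + (x⁺ + y⁺))
          = ((x + y)⁺ - (x + y)⁻) - (x⁺ - x⁻) - (y⁺ - y⁻) := by abel
        _ = 0 := by rw [h1, h2, h3]; abel
    have h' := congrArg (coneSup f) h
    rw [coneSup_add f (posPart_nonneg _) (add_nonneg (negPart_nonneg _) (negPart_nonneg _)),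
      coneSup_add f (negPart_nonneg _) (negPart_nonneg _),
      coneSup_add f (negPart_nonneg _) (add_nonneg (posPart_nonneg _) (posPart_nonneg _)),
      coneSup_add f (posPart_nonneg _) (posPart_nonneg _)] at h'
    linarith

theorem coneSup_nonneg (f : StrongDual ℝ E) {x : E} (hx : 0 ≤ x) : 0 ≤ coneSup f x := by
  simpa using le_coneSup f le_rfl hx

theorem dualPosAddHom_of_nonneg (f : StrongDual ℝ E) {x : E} (hx : 0 ≤ x) :
    dualPosAddHom f x = coneSup f x := by
  have h0 : coneSup f (0 : E) = 0 := by
    have h := coneSup_add f (le_refl (0 : E)) (le_refl (0 : E))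
    rw [add_zero] at h
    linarith
  change coneSup f x⁺ - coneSup f x⁻ = _
  rw [posPart_of_nonneg hx, negPart_of_nonneg hx, h0, sub_zero]

theorem coneSup_le_norm (f : StrongDual ℝ E) {x : E} (hx : 0 ≤ x) : coneSup f x ≤ ‖f‖ * ‖x‖ :=
  coneSup_le f hx fun _ hy hyx => le_norm_of_mem_Icc f ⟨hy, hyx⟩

theorem dualPosAddHom_bound (f : StrongDual ℝ E) (x : E) : ‖dualPosAddHom f x‖ ≤ ‖f‖ * ‖x‖ := by
  have h1 := coneSup_le_norm f (posPart_nonneg x)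
  have h2 := coneSup_le_norm f (negPart_nonneg x)
  have p1 := coneSup_nonneg f (posPart_nonneg x)
  have p2 := coneSup_nonneg f (negPart_nonneg x)
  have n1 : ‖x⁺‖ ≤ ‖x‖ := norm_le_norm_of_abs_le_abs (by
    rw [abs_of_nonneg (posPart_nonneg x), ← posPart_add_negPart x]
    exact le_add_of_nonneg_right (negPart_nonneg x))
  have n2 : ‖x⁻‖ ≤ ‖x‖ := norm_le_norm_of_abs_le_abs (by
    rw [abs_of_nonneg (negPart_nonneg x), ← posPart_add_negPart x]
    exact le_add_of_nonneg_left (posPart_nonneg x))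
  have m1 := mul_le_mul_of_nonneg_left n1 (norm_nonneg f)
  have m2 := mul_le_mul_of_nonneg_left n2 (norm_nonneg f)
  change ‖coneSup f x⁺ - coneSup f x⁻‖ ≤ _
  rw [Real.norm_eq_abs, abs_le]
  constructor <;> linarith

/-- The positive part of a functional: the continuous linear map given by
`x ↦ sup {f y : 0 ≤ y ≤ x}` on the positive cone (Riesz-Kantorovich formula). -/
noncomputable def dualPos (f : StrongDual ℝ E) : StrongDual ℝ E :=
  (dualPosAddHom f).toRealLinearMap
    (AddMonoidHomClass.continuous_of_bound (dualPosAddHom f) ‖f‖ (dualPosAddHom_bound f))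

theorem dualPos_of_nonneg (f : StrongDual ℝ E) {x : E} (hx : 0 ≤ x) :
    dualPos f x = coneSup f x := dualPosAddHom_of_nonneg f hx

theorem le_dualPos (f : StrongDual ℝ E) : f ≤ dualPos f := fun x hx => by
  rw [dualPos_of_nonneg f hx]
  exact le_coneSup f hx le_rfl

theorem dualPos_nonneg (f : StrongDual ℝ E) : 0 ≤ dualPos f := fun x hx => by
  rw [dualPos_of_nonneg f hx]
  exact coneSup_nonneg f hx

theorem dualPos_le {f g : StrongDual ℝ E} (hfg : f ≤ g) (hg : 0 ≤ g) : dualPos f ≤ g :=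
    fun x hx => by
  rw [dualPos_of_nonneg f hx]
  refine coneSup_le f hx fun y hy hyx => (hfg y hy).trans ?_
  have h := hg (x - y) (sub_nonneg.2 hyx)
  rw [map_sub] at h
  simpa using h

/-- The lattice operations of the dual; as suprema and infima they are determined by the dual
order. -/
noncomputable instance dualLattice : Lattice (StrongDual ℝ E) where
  __ := dualPartialOrder
  sup f g := dualPos (f - g) + g
  inf f g := f - dualPos (f - g)
  le_sup_left f g := sub_le_iff_le_add.1 (le_dualPos (f - g))
  le_sup_right f g := le_add_of_nonneg_left (dualPos_nonneg (f - g))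
  sup_le _ g _ hf hg := le_sub_iff_add_le.1
    (dualPos_le (sub_le_sub_right hf g) (sub_nonneg.2 hg))
  inf_le_left f g := sub_le_self f (dualPos_nonneg (f - g))
  inf_le_right f g := sub_le_comm.1 (le_dualPos (f - g))
  le_inf f g _ hg hh := le_sub_comm.1
    (dualPos_le (sub_le_sub_left hh g) (sub_nonneg.2 hg))

theorem dual_abs_apply_le (g : StrongDual ℝ E) {u : E} (hu : 0 ≤ u) : |g| u ≤ ‖g‖ * ‖u‖ := by
  have e : |g| u = coneSup (g - -g) u - g u := by
    change (dualPos (g - -g) + -g) u = _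
    rw [add_apply, dualPos_of_nonneg _ hu, neg_apply]
    ring
  rw [e, sub_le_iff_le_add]
  refine coneSup_le _ hu fun y hy hyu => ?_
  have h1 : (g - -g) y = g (y - (u - y)) + g u := by
    rw [← map_add, sub_apply, neg_apply, sub_neg_eq_add,
      ← map_add]
    congr 1
    abel
  have h2 : ‖y - (u - y)‖ ≤ ‖u‖ := by
    apply norm_le_norm_of_abs_le_abs
    rw [abs_of_nonneg hu]
    refine abs_le'.2 ⟨(sub_le_self y (sub_nonneg.2 hyu)).trans hyu, ?_⟩
    rw [neg_sub]
    exact (sub_le_self _ hy).trans (sub_le_self _ hy)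
  rw [h1]
  refine add_le_add ?_ le_rfl
  exact (le_abs_self _).trans ((g.le_opNorm _).trans
    (mul_le_mul_of_nonneg_left h2 (norm_nonneg g)))

/-- The dual norm is a lattice norm, so the dual of a Banach lattice is a Banach lattice. -/
instance dualHasSolidNorm : HasSolidNorm (StrongDual ℝ E) where
  solid f g hfg := by
    refine f.opNorm_le_bound (norm_nonneg g) fun x => ?_
    have hle : |f x| ≤ |f| |x| := by
      have h1 : ∀ u : E, 0 ≤ u → |f u| ≤ |f| u := fun u hu =>
        abs_le'.2 ⟨le_abs_self f u hu, neg_le_abs f u hu⟩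
      calc |f x| = |f x⁺ - f x⁻| := by rw [← map_sub, posPart_sub_negPart]
        _ ≤ |f x⁺| + |f x⁻| := abs_sub _ _
        _ ≤ |f| x⁺ + |f| x⁻ := add_le_add (h1 _ (posPart_nonneg x)) (h1 _ (negPart_nonneg x))
        _ = |f| |x| := by rw [← map_add, posPart_add_negPart]
    calc ‖f x‖ ≤ |f| |x| := hle
      _ ≤ |g| |x| := hfg _ (abs_nonneg x)
      _ ≤ ‖g‖ * ‖|x|‖ := dual_abs_apply_le g (abs_nonneg x)
      _ = ‖g‖ * ‖x‖ := by rw [norm_abs_eq_norm]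

end Dual

/-! ### The Banach lattice `ℓ¹` -/

/-- The real sequence space `ℓ¹`, with its usual norm. -/
abbrev ellOne : Type := lp (fun _ : ℕ => ℝ) 1

/-- The coordinatewise order of `ℓ¹`. -/
instance ellOnePartialOrder : PartialOrder ellOne where
  le x y := ∀ n, x n ≤ y n
  le_refl x n := le_refl (x n)
  le_trans x y z hxy hyz n := (hxy n).trans (hyz n)
  le_antisymm x y hxy hyx := lp.ext (funext fun n => le_antisymm (hxy n) (hyx n))

theorem memℓp_of_abs_le {z : ℕ → ℝ} (x y : ellOne) (h : ∀ n, |z n| ≤ |x n| + |y n|) :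
    Memℓp z 1 := by
  have hx := (lp.memℓp x).summable (by simp)
  have hy := (lp.memℓp y).summable (by simp)
  refine memℓp_gen ?_
  simp only [ENNReal.toReal_one, Real.rpow_one, Real.norm_eq_abs] at hx hy ⊢
  exact Summable.of_nonneg_of_le (fun n => abs_nonneg _) h (hx.add hy)

/-- The coordinatewise lattice operations of `ℓ¹`. -/
noncomputable instance ellOneLattice : Lattice ellOne where
  __ := ellOnePartialOrder
  sup x y := ⟨fun n => x n ⊔ y n, memℓp_of_abs_le x y fun _ => abs_max_le_max_abs_abs.trans
    (max_le (le_add_of_nonneg_right (abs_nonneg _)) (le_add_of_nonneg_left (abs_nonneg _)))⟩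
  inf x y := ⟨fun n => x n ⊓ y n, memℓp_of_abs_le x y fun _ => abs_min_le_max_abs_abs.trans
    (max_le (le_add_of_nonneg_right (abs_nonneg _)) (le_add_of_nonneg_left (abs_nonneg _)))⟩
  le_sup_left x y n := le_max_left (x n) (y n)
  le_sup_right x y n := le_max_right (x n) (y n)
  sup_le _ _ _ hx hy n := max_le (hx n) (hy n)
  inf_le_left x y n := min_le_left (x n) (y n)
  inf_le_right x y n := min_le_right (x n) (y n)
  le_inf _ _ _ hx hy n := le_min (hx n) (hy n)

/-! ### The notions of the statement -/

/-- `F` contains a lattice copy of `X`: there is a linear homeomorphism of `X` onto a subspace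
of `F` (a bounded linear map that is bounded below) which is a Riesz homomorphism. -/
def ContainsLatticeCopy (X F : Type*) [NormedAddCommGroup X] [NormedSpace ℝ X] [Lattice X]
    [NormedAddCommGroup F] [NormedSpace ℝ F] [Lattice F] : Prop :=
  ∃ T : X →L[ℝ] F, (∀ x y : X, T (x ⊔ y) = T x ⊔ T y) ∧ (∀ x y : X, T (x ⊓ y) = T x ⊓ T y) ∧
    ∃ c : ℝ, 0 < c ∧ ∀ x : X, c * ‖x‖ ≤ ‖T x‖

/-- The positive Schur property: every weakly null sequence of positive vectors is norm null. -/
def PositiveSchurProperty (X : Type*) [SeminormedAddCommGroup X] [NormedSpace ℝ X] [Preorder X] :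
    Prop :=
  ∀ x : ℕ → X, (∀ n, 0 ≤ x n) →
    Tendsto (fun n => toWeakSpace ℝ X (x n)) atTop (𝓝 0) → Tendsto x atTop (𝓝 0)

/-- A closed ideal: a norm closed, solid linear subspace. -/
def IsClosedIdeal (X : Type*) [NormedAddCommGroup X] [NormedSpace ℝ X] [Lattice X]
    (I : Submodule ℝ X) : Prop :=
  IsClosed (I : Set X) ∧ LatticeOrderedAddCommGroup.IsSolid (I : Set X)

/-- The quotient `X ⧸ I`, with the quotient norm and the quotient order. -/
def LatticeQuotient (X : Type*) [NormedAddCommGroup X] [NormedSpace ℝ X] (I : Submodule ℝ X) :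
    Type _ := X ⧸ I

section Quotient

variable {X : Type*} [NormedAddCommGroup X] [NormedSpace ℝ X] (I : Submodule ℝ X)

/-- The quotient norm; it is only a seminorm if `I` is not closed. -/
noncomputable instance : SeminormedAddCommGroup (LatticeQuotient X I) :=
  inferInstanceAs (SeminormedAddCommGroup (X ⧸ I))

noncomputable instance : NormedSpace ℝ (LatticeQuotient X I) :=
  inferInstanceAs (NormedSpace ℝ (X ⧸ I))

/-- The quotient order: `a ≤ b` iff `x ≤ y` for some representatives `x` of `a` and `y` of `b`. -/
instance [Lattice X] [IsOrderedAddMonoid X] : Preorder (LatticeQuotient X I) where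
  le a b := ∃ x y : X, I.mkQ x = a ∧ I.mkQ y = b ∧ x ≤ y
  le_refl a := by
    obtain ⟨x, rfl⟩ := I.mkQ_surjective a
    exact ⟨x, x, rfl, rfl, le_rfl⟩
  le_trans a b c := by
    rintro ⟨x, y, rfl, rfl, hxy⟩ ⟨y', z, hy, rfl, hyz⟩
    refine ⟨x + (y' - y), z, ?_, rfl, ?_⟩
    · rw [map_add, map_sub, hy, sub_self, add_zero]
    · calc x + (y' - y) ≤ y + (y' - y) := add_le_add_left hxy _
        _ = y' := by abel
        _ ≤ z := hyz

end Quotient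

/-- The canonical copy of `E` in its bidual, the range of the evaluation map. -/
noncomputable def canonicalImage (E : Type*) [NormedAddCommGroup E] [NormedSpace ℝ E] :
    Submodule ℝ (StrongDual ℝ (StrongDual ℝ E)) :=
  LinearMap.range (NormedSpace.inclusionInDoubleDual ℝ E).toLinearMap

end BanachLat

namespace BanachLat

/-! ### Weak nullity and order intervals under the positive Schur property -/

section Basic

/-! One mechanism runs through the proof: positive vectors whose partial sums stay bounded against
each positive functional are weakly null. In `E` they are therefore norm null; in `E**` and `E**/E`
the failure is shown by such sequences that stay away from `0`.

Ideal: order bounded increasing sequences of `E` converge in norm, so up to `ε` the norm on `[0, x]`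
is dominated by one positive functional `g` (`exists_norm_le_apply_add`). The interval `[0, x]` of
`E` is weak* dense in that of `E**`. A parallelogram argument, with `g` measuring an abstract
square, upgrades weak* approximation to norm approximation (`exists_mem_Icc_norm_sub_le`). As the
copy of `[0, x]` is norm closed, it is the whole interval of `E**`.

Failure: the unit vectors of `ℓ¹` give disjoint bounded `u k` in `E*` and a positive `φ` in `E**`
with `φ (u k) ≥ 1`. The parts `ψ k` of `φ` living on `u k` have norms bounded below and partial sums
at most `φ`. Regrouping them into infinite blocks yields `Ψ n`, again with partial sums at most `φ`.
For `y` in `E` the meets of `|y|` with the members of a block lie in `E` and are weakly null, hence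
norm null; so each `Ψ n` has distance at least a fixed `δ > 0` from `E` (`le_norm_sub`). The `Ψ n`
refute the property in `E**`, and their classes refute it in `E**/E`. -/

theorem tendsto_toWeakSpace_zero {X : Type*} [SeminormedAddCommGroup X] [NormedSpace ℝ X]
    {x : ℕ → X} (h : ∀ f : StrongDual ℝ X, Tendsto (fun n => f (x n)) atTop (𝓝 0)) :
    Tendsto (fun n => toWeakSpace ℝ X (x n)) atTop (𝓝 0) := by
  have hi : Topology.IsInducing (fun (x : WeakSpace ℝ X) (f : StrongDual ℝ X) =>
      (topDualPairing ℝ X).flip x f) := ⟨rfl⟩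
  refine hi.tendsto_nhds_iff.2 (tendsto_pi_nhds.2 fun f => ?_)
  have h0 : (topDualPairing ℝ X).flip (0 : WeakSpace ℝ X) f = 0 := f.map_zero
  rw [h0]
  exact h f

variable {X : Type*} [NormedAddCommGroup X] [NormedSpace ℝ X] [Lattice X] [IsOrderedAddMonoid X]

theorem apply_nonneg {f : StrongDual ℝ X} (hf : 0 ≤ f) {x : X} (hx : 0 ≤ x) : 0 ≤ f x := by
  simpa using hf x hx

theorem apply_mono {f : StrongDual ℝ X} (hf : 0 ≤ f) {x y : X} (hxy : x ≤ y) : f x ≤ f y := by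
  have := apply_nonneg hf (sub_nonneg.2 hxy)
  rw [map_sub] at this
  linarith

theorem sum_le_of_injective {φ : StrongDual ℝ X} {ψ : ℕ → StrongDual ℝ X} (hψ : ∀ k, 0 ≤ ψ k)
    (hφ : ∀ N, ∑ k ∈ Finset.range N, ψ k ≤ φ) {σ : ℕ → ℕ} (hσ : Function.Injective σ) (N : ℕ) :
    ∑ j ∈ Finset.range N, ψ (σ j) ≤ φ := by
  have hM : (Finset.range N).image σ ⊆ Finset.range ((Finset.range N).sup σ + 1) := by
    intro k hk
    obtain ⟨j, hj, rfl⟩ := Finset.mem_image.1 hk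
    exact Finset.mem_range.2 (Nat.lt_succ_of_le (Finset.le_sup (f := σ) hj))
  rw [← Finset.sum_image (f := ψ) fun i _ j _ hij => hσ hij]
  exact (Finset.sum_le_sum_of_subset_of_nonneg hM fun k _ _ => hψ k).trans (hφ _)

variable [HasSolidNorm X]

theorem abs_apply_le_abs_apply (f : StrongDual ℝ X) {x : X} (hx : 0 ≤ x) : |f x| ≤ |f| x :=
  abs_le'.2 ⟨le_abs_self f x hx, neg_le_abs f x hx⟩

theorem tendsto_apply_zero_of_sum_le {x : ℕ → X} (hx : ∀ n, 0 ≤ x n)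
    (hb : ∀ f : StrongDual ℝ X, 0 ≤ f → ∃ C, ∀ N, ∑ n ∈ Finset.range N, f (x n) ≤ C)
    (f : StrongDual ℝ X) : Tendsto (fun n => f (x n)) atTop (𝓝 0) := by
  obtain ⟨C, hC⟩ := hb |f| (abs_nonneg f)
  have hs := (summable_of_sum_range_le (fun n => apply_nonneg (abs_nonneg f) (hx n))
    hC).tendsto_atTop_zero
  exact squeeze_zero_norm (fun n => abs_apply_le_abs_apply f (hx n)) hs

theorem tendsto_weak_zero_of_sum_le {x : ℕ → X} (hx : ∀ n, 0 ≤ x n)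
    (hb : ∀ f : StrongDual ℝ X, 0 ≤ f → ∃ C, ∀ N, ∑ n ∈ Finset.range N, f (x n) ≤ C) :
    Tendsto (fun n => toWeakSpace ℝ X (x n)) atTop (𝓝 0) :=
  tendsto_toWeakSpace_zero (tendsto_apply_zero_of_sum_le hx hb)

theorem exists_nonneg_norming {x : X} (hx : 0 ≤ x) :
    ∃ f : StrongDual ℝ X, 0 ≤ f ∧ ‖f‖ ≤ 1 ∧ ‖x‖ ≤ f x := by
  obtain ⟨f, hf, hfx⟩ := exists_dual_vector'' ℝ x
  refine ⟨|f|, abs_nonneg f, by rwa [norm_abs_eq_norm], ?_⟩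
  rw [show ‖x‖ = f x from hfx.symm]
  exact le_abs_self f x hx

/-- If the sequence were not Cauchy, some increments would have norm at least `ε`. Their sums
telescope below `b`, so they are weakly null, hence norm null. -/
theorem PositiveSchurProperty.exists_tendsto_of_monotone [CompleteSpace X]
    (hX : PositiveSchurProperty X) {x : ℕ → X} (hx : Monotone x) {b : X} (hb : ∀ n, x n ≤ b) :
    ∃ l, Tendsto x atTop (𝓝 l) := by
  refine cauchySeq_tendsto_of_complete (Metric.cauchySeq_iff'.2 ?_)
  by_contra! hcon
  obtain ⟨ε, hε, h⟩ := hcon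
  choose nxt hnxt hd using h
  set N : ℕ → ℕ := fun k => nxt^[k] 0 with hN
  have hNs : ∀ k, N (k + 1) = nxt (N k) := fun k => Function.iterate_succ_apply' nxt k 0
  set u : ℕ → X := fun k => x (N (k + 1)) - x (N k) with hu
  have hu0 : ∀ k, 0 ≤ u k := fun k => sub_nonneg.2 (hx (by rw [hNs]; exact hnxt _))
  have hlim := hX u hu0 (tendsto_weak_zero_of_sum_le hu0 fun f hf => ⟨f b - f (x (N 0)),
    fun K => by
      simp only [hu, map_sub]
      rw [Finset.sum_range_sub (fun k => f (x (N k)))]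
      exact sub_le_sub_right (apply_mono hf (hb _)) _⟩)
  have h1 := tendsto_norm_zero.comp hlim
  refine absurd (ge_of_tendsto' h1 (b := ε) fun k => ?_) (not_le.2 hε)
  have := hd (N k)
  rw [← hNs, dist_eq_norm] at this
  exact this

/-- The norm of an order interval is controlled, up to `ε`, by a single positive functional. -/
theorem PositiveSchurProperty.exists_norm_le_apply_add [CompleteSpace X]
    (hX : PositiveSchurProperty X) (x : X) {ε : ℝ} (hε : 0 < ε) :
    ∃ g : StrongDual ℝ X, 0 ≤ g ∧ ∀ w, 0 ≤ w → w ≤ x → ‖w‖ ≤ g w + ε := by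
  by_contra! hcon
  -- Positivity of `g` is a premise inside the existential, so that `W` and `F` are total and `S`
  -- can be defined before its positivity is known.
  have hcon' : ∀ g : StrongDual ℝ X, ∃ w : X, ∃ f : StrongDual ℝ X, 0 ≤ g →
      0 ≤ w ∧ w ≤ x ∧ 0 ≤ f ∧ ‖f‖ ≤ 1 ∧ g w + ε ≤ f w := by
    intro g
    by_cases hg : 0 ≤ g
    · obtain ⟨w, hw, hwx, hlt⟩ := hcon g hg
      obtain ⟨f, hf, hf1, hfw⟩ := exists_nonneg_norming hw
      exact ⟨w, f, fun _ => ⟨hw, hwx, hf, hf1, hlt.le.trans hfw⟩⟩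
    · exact ⟨0, 0, fun h => absurd h hg⟩
  choose W F hWF using hcon'
  -- `S n` is the sum of the earlier functionals `f i`, `i < n`. Testing against `2 ^ n • S n`
  -- forces `f i (w n) ≤ ‖x‖ / 2 ^ n` for all `i < n`, which is summable in `n`.
  let S : ℕ → StrongDual ℝ X := fun n =>
    Nat.rec 0 (fun n s => s + F ((2 ^ n : ℝ) • s)) n
  have hSs : ∀ n, S (n + 1) = S n + F ((2 ^ n : ℝ) • S n) := fun n => rfl
  have hS0 : ∀ n, 0 ≤ S n := by
    intro n
    induction n with
    | zero => exact le_rfl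
    | succ n ih =>
      rw [hSs]
      exact add_nonneg ih (hWF _ (smul_nonneg (by positivity) ih)).2.2.1
  have key := fun n => hWF ((2 ^ n : ℝ) • S n) (smul_nonneg (by positivity) (hS0 n))
  set w : ℕ → X := fun n => W ((2 ^ n : ℝ) • S n)
  set f : ℕ → StrongDual ℝ X := fun n => F ((2 ^ n : ℝ) • S n)
  have hSm : Monotone S := monotone_nat_of_le_succ fun n => by
    rw [hSs]; exact le_add_of_nonneg_right (key n).2.2.1
  have hfS : ∀ i n, i < n → f i ≤ S n := fun i n hin => by
    refine le_trans ?_ (hSm (Nat.succ_le_of_lt hin))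
    rw [Nat.succ_eq_add_one, hSs]
    exact le_add_of_nonneg_left (hS0 i)
  have hw0 : ∀ n, 0 ≤ w n := fun n => (key n).1
  have hwx : ∀ n, w n ≤ x := fun n => (key n).2.1
  have hfw : ∀ i n, i < n → f i (w n) ≤ ‖x‖ * (1 / 2) ^ n := by
    intro i n hin
    refine (hfS i n hin _ (hw0 n)).trans ?_
    have h1 := (key n).2.2.2.2
    have h2 : f n (w n) ≤ ‖x‖ := by
      refine (le_abs_self _).trans (((f n).le_opNorm _).trans ?_)
      calc ‖f n‖ * ‖w n‖ ≤ 1 * ‖x‖ := mul_le_mul (key n).2.2.2.1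
            (norm_le_of_nonneg_le (hw0 n) (hwx n)) (norm_nonneg _) zero_le_one
        _ = ‖x‖ := one_mul _
    have h3 : (2 : ℝ) ^ n * S n (w n) ≤ ‖x‖ := by
      have : ((2 ^ n : ℝ) • S n) (w n) = (2 : ℝ) ^ n * S n (w n) := rfl
      rw [← this]
      change _ + ε ≤ f n (w n) at h1
      linarith
    rw [one_div, inv_pow, ← div_eq_mul_inv, le_div_iff₀ (by positivity)]
    linarith
  -- the tail suprema
  have hs : ∀ n, ∃ l, Tendsto (partialSups fun k => w (n + k)) atTop (𝓝 l) := fun n =>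
    hX.exists_tendsto_of_monotone (partialSups _).monotone (b := x) fun N =>
      partialSups_le _ _ _ fun j _ => hwx _
  choose s hs using hs
  have hws : ∀ n k, w (n + k) ≤ s n := fun n k =>
    ge_of_tendsto (hs n) (eventually_atTop.2 ⟨k, fun N hN =>
      le_partialSups_of_le (fun k => w (n + k)) hN⟩)
  have hsa : Antitone s := antitone_nat_of_succ_le fun n =>
    le_of_tendsto' (hs (n + 1)) fun N => partialSups_le _ _ _ fun j _ => by
      have := hws n (1 + j)
      rwa [← add_assoc] at this
  have hs0 : ∀ n, 0 ≤ s n := fun n => (hw0 _).trans (hws n 0)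
  have hfs : ∀ i n, i < n → f i (s n) ≤ ‖x‖ * (1 / 2) ^ n * 2 := by
    intro i n hin
    refine le_of_tendsto' (((f i).continuous.tendsto _).comp (hs n)) fun N => ?_
    have h1 : partialSups (fun k => w (n + k)) N ≤ ∑ k ∈ Finset.range (N + 1), w (n + k) :=
      partialSups_le _ _ _ fun j hj =>
        Finset.single_le_sum (f := fun k => w (n + k)) (fun k _ => hw0 _)
          (Finset.mem_range.2 (Nat.lt_succ_of_le hj))
    refine (apply_mono (key i).2.2.1 h1).trans ?_
    rw [map_sum]
    calc ∑ k ∈ Finset.range (N + 1), f i (w (n + k))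
        ≤ ∑ k ∈ Finset.range (N + 1), ‖x‖ * (1 / 2) ^ n * (1 / 2) ^ k :=
          Finset.sum_le_sum fun k _ => (hfw i (n + k) (by omega)).trans
            (by rw [pow_add, mul_assoc])
      _ = ‖x‖ * (1 / 2) ^ n * ∑ k ∈ Finset.range (N + 1), (1 / 2 : ℝ) ^ k := by
          rw [Finset.mul_sum]
      _ ≤ ‖x‖ * (1 / 2) ^ n * 2 :=
          mul_le_mul_of_nonneg_left (sum_geometric_two_le _) (by positivity)
  -- The decreasing tail suprema `s n` converge to `-l`, where no `f i` is positive. Hence `ε ≤ f n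
  -- (w n) ≤ f n (s n) ≤ ‖s n - -l‖`, which tends to `0`.
  obtain ⟨l, hl⟩ := hX.exists_tendsto_of_monotone (x := fun n => -s n)
    (fun m n h => neg_le_neg (hsa h)) (b := 0) (fun n => neg_nonpos.2 (hs0 n))
  have hl' : Tendsto s atTop (𝓝 (-l)) := by simpa using hl.neg
  have hfl : ∀ i, f i (-l) ≤ 0 := by
    intro i
    have h1 : Tendsto (fun n : ℕ => ‖x‖ * (1 / 2 : ℝ) ^ n * 2) atTop (𝓝 0) := by
      simpa using ((tendsto_pow_atTop_nhds_zero_of_lt_one (r := (1 / 2 : ℝ)) (by norm_num)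
        (by norm_num)).const_mul ‖x‖).mul_const 2
    exact le_of_tendsto_of_tendsto (((f i).continuous.tendsto _).comp hl') h1
      (eventually_atTop.2 ⟨i + 1, fun n hn => hfs i n hn⟩)
  have h2 : Tendsto (fun n => ‖s n - -l‖) atTop (𝓝 0) := by
    simpa using (hl'.sub_const (-l)).norm
  refine absurd (ge_of_tendsto' h2 (b := ε) fun n => ?_) (not_le.2 hε)
  have h3 : ε ≤ f n (w n) := by
    have h4 := apply_nonneg (smul_nonneg (by positivity) (hS0 n) : 0 ≤ (2 ^ n : ℝ) • S n) (hw0 n)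
    have h5 := (key n).2.2.2.2
    linarith
  have h4 : f n (w n) ≤ f n (s n) := apply_mono (key n).2.2.1 (hws n 0)
  have h5 : f n (s n - -l) ≤ ‖s n - -l‖ :=
    (le_abs_self _).trans (((f n).le_opNorm _).trans
      (mul_le_of_le_one_left (norm_nonneg _) (key n).2.2.2.1))
  rw [map_sub] at h5
  linarith [hfl n]

end Basic

/-! ### Splitting a positive functional over disjoint vectors -/

section Components

theorem inf_add_eq_zero {X : Type*} [AddCommGroup X] [Lattice X] [IsOrderedAddMonoid X]
    {a b c : X} (ha : 0 ≤ a) (hb : 0 ≤ b) (hc : 0 ≤ c) (hab : a ⊓ b = 0) (hac : a ⊓ c = 0) :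
    a ⊓ (b + c) = 0 := by
  refine le_antisymm ?_ (le_inf ha (add_nonneg hb hc))
  have h1 : a ⊓ (b + c) - c ≤ a ⊓ b :=
    le_inf ((sub_le_self _ hc).trans inf_le_left) (sub_le_iff_le_add.2 inf_le_right)
  rw [hab, sub_nonpos] at h1
  exact (le_inf inf_le_left h1).trans_eq hac

theorem inf_nsmul_eq_zero {X : Type*} [AddCommGroup X] [Lattice X] [IsOrderedAddMonoid X]
    {a b : X} (ha : 0 ≤ a) (hb : 0 ≤ b) (hab : a ⊓ b = 0) (m : ℕ) : a ⊓ m • b = 0 := by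
  induction m with
  | zero => simpa using ha
  | succ m ih =>
    rw [succ_nsmul]
    exact inf_add_eq_zero ha (nsmul_nonneg hb m) hb ih hab

/-- Disjoint positive vectors have their supremum as sum. -/
theorem sum_le_of_pairwise_inf_eq_zero {X : Type*} [AddCommGroup X] [Lattice X]
    [IsOrderedAddMonoid X] {y : ℕ → X} {x : X} (hx : 0 ≤ x) (hy : ∀ k, 0 ≤ y k)
    (hyx : ∀ k, y k ≤ x) (hd : ∀ k l, k ≠ l → y k ⊓ y l = 0) (N : ℕ) :
    ∑ k ∈ Finset.range N, y k ≤ x := by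
  have hdis : ∀ M l, M ≤ l → y l ⊓ ∑ k ∈ Finset.range M, y k = 0 := by
    intro M
    induction M with
    | zero => intro l _; simpa using hy l
    | succ M ih =>
      intro l hl
      rw [Finset.sum_range_succ]
      exact inf_add_eq_zero (hy l) (Finset.sum_nonneg fun k _ => hy k) (hy M)
        (ih l (by omega)) (hd l M (by omega))
  induction N with
  | zero => simpa using hx
  | succ N ih =>
    rw [Finset.sum_range_succ, ← inf_add_sup, inf_comm, hdis N N le_rfl, zero_add]
    exact sup_le ih (hyx N)

variable {X : Type*} [NormedAddCommGroup X] [NormedSpace ℝ X] [Lattice X] [IsOrderedAddMonoid X]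
  [HasSolidNorm X]

/-- An additive, positive and bounded function on the positive cone extends to a functional. -/
theorem exists_functional_of_cone (F : X → ℝ)
    (hadd : ∀ a b, 0 ≤ a → 0 ≤ b → F (a + b) = F a + F b) (h0 : ∀ a, 0 ≤ a → 0 ≤ F a) (C : ℝ)
    (hC : ∀ a, 0 ≤ a → F a ≤ C * ‖a‖) :
    ∃ ψ : StrongDual ℝ X, 0 ≤ ψ ∧ ∀ a, 0 ≤ a → ψ a = F a := by
  have hF0 : F 0 = 0 := by
    have := hadd 0 0 le_rfl le_rfl
    rw [add_zero] at this
    linarith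
  let G : X →+ ℝ := AddMonoidHom.mk' (fun x => F x⁺ - F x⁻) fun x y => by
    have h : (x + y)⁺ + (x⁻ + y⁻) = (x + y)⁻ + (x⁺ + y⁺) := by
      rw [← sub_eq_zero]
      calc (x + y)⁺ + (x⁻ + y⁻) - ((x + y)⁻ + (x⁺ + y⁺))
          = ((x + y)⁺ - (x + y)⁻) - (x⁺ - x⁻) - (y⁺ - y⁻) := by abel
        _ = 0 := by simp only [posPart_sub_negPart]; abel
    have h' := congrArg F h
    rw [hadd _ _ (posPart_nonneg _) (add_nonneg (negPart_nonneg _) (negPart_nonneg _)),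
      hadd _ _ (negPart_nonneg _) (negPart_nonneg _),
      hadd _ _ (negPart_nonneg _) (add_nonneg (posPart_nonneg _) (posPart_nonneg _)),
      hadd _ _ (posPart_nonneg _) (posPart_nonneg _)] at h'
    linarith
  have hG : ∀ x, G x = F x⁺ - F x⁻ := fun x => rfl
  have hGC : ∀ x, ‖G x‖ ≤ C * ‖x‖ := by
    intro x
    have e : F |x| = F x⁺ + F x⁻ := by
      rw [← posPart_add_negPart, hadd _ _ (posPart_nonneg x) (negPart_nonneg x)]
    have h1 := hC |x| (abs_nonneg x)
    rw [norm_abs_eq_norm] at h1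
    have p1 := h0 _ (posPart_nonneg x)
    have p2 := h0 _ (negPart_nonneg x)
    rw [hG, Real.norm_eq_abs, abs_le]
    constructor <;> linarith
  have hGa : ∀ a, 0 ≤ a → G a = F a := fun a ha => by
    rw [hG, posPart_of_nonneg ha, negPart_of_nonneg ha, hF0, sub_zero]
  refine ⟨G.toRealLinearMap (AddMonoidHomClass.continuous_of_bound G C hGC), ?_, hGa⟩
  intro a ha
  exact (h0 a ha).trans_eq (hGa a ha).symm

/-- The part of a positive functional that lives on the principal ideal generated by `u`. -/
theorem exists_principal_part {φ : StrongDual ℝ X} (hφ : 0 ≤ φ) {u : X} (hu : 0 ≤ u) :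
    ∃ ψ : StrongDual ℝ X, 0 ≤ ψ ∧ φ u ≤ ψ u ∧ ∀ x, 0 ≤ x → ∀ δ > 0,
      ∃ y, 0 ≤ y ∧ y ≤ x ∧ (∃ m : ℕ, y ≤ m • u) ∧ ψ x < φ y + δ := by
  -- `F x` is the supremum of `φ (x ⊓ m • u)` over `m`. Admitting all smaller `y` lets additivity
  -- follow by Riesz decomposition.
  let P : X → Set X := fun x => {y | 0 ≤ y ∧ y ≤ x ∧ ∃ m : ℕ, y ≤ m • u}
  let F : X → ℝ := fun x => sSup (φ '' P x)
  have hzero : ∀ x, 0 ≤ x → (0 : X) ∈ P x := fun x hx => ⟨le_rfl, hx, 0, by simp⟩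
  have hbdd : ∀ x, BddAbove (φ '' P x) := by
    rintro x
    refine ⟨φ x, ?_⟩
    rintro _ ⟨y, hy, rfl⟩
    exact apply_mono hφ hy.2.1
  have le_F : ∀ x y, y ∈ P x → φ y ≤ F x := fun x y hy => le_csSup (hbdd x) ⟨y, hy, rfl⟩
  have F_le : ∀ x c, 0 ≤ x → (∀ y ∈ P x, φ y ≤ c) → F x ≤ c := fun x c hx h => by
    refine csSup_le ⟨_, 0, hzero x hx, rfl⟩ ?_
    rintro _ ⟨y, hy, rfl⟩
    exact h y hy
  have F_nonneg : ∀ x, 0 ≤ x → 0 ≤ F x := fun x hx => by simpa using le_F x 0 (hzero x hx)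
  have F_le_φ : ∀ x, 0 ≤ x → F x ≤ φ x := fun x hx =>
    F_le x _ hx fun y hy => apply_mono hφ hy.2.1
  have F_add : ∀ a b, 0 ≤ a → 0 ≤ b → F (a + b) = F a + F b := by
    intro a b ha hb
    apply le_antisymm
    · refine F_le _ _ (add_nonneg ha hb) ?_
      rintro y ⟨hy, hyab, m, hm⟩
      have e : φ y = φ (y ⊓ a) + φ (y - y ⊓ a) := by rw [← map_add]; congr 1; abel
      rw [e]
      refine add_le_add (le_F _ _ ⟨le_inf hy ha, inf_le_right, m, inf_le_left.trans hm⟩)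
        (le_F _ _ ⟨sub_nonneg.2 inf_le_left, ?_, m, (sub_le_self _ (le_inf hy ha)).trans hm⟩)
      exact sub_le_comm.1 (le_inf (sub_le_self y hb) (sub_le_iff_le_add.2 hyab))
    · rw [← le_sub_iff_add_le]
      refine F_le _ _ ha ?_
      rintro y ⟨hy, hya, m, hm⟩
      rw [le_sub_comm]
      refine F_le _ _ hb ?_
      rintro z ⟨hz, hzb, n, hn⟩
      rw [le_sub_iff_add_le, ← map_add, add_comm]
      exact le_F _ _ ⟨add_nonneg hy hz, add_le_add hya hzb, m + n, by
        rw [add_nsmul]; exact add_le_add hm hn⟩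
  obtain ⟨ψ, hψ, hψF⟩ := exists_functional_of_cone F F_add F_nonneg ‖φ‖
    fun a ha => (F_le_φ a ha).trans ((le_abs_self _).trans (φ.le_opNorm a))
  refine ⟨ψ, hψ, ?_, fun x hx δ hδ => ?_⟩
  · rw [hψF u hu]
    exact le_F _ _ ⟨hu, le_rfl, 1, by simp⟩
  · obtain ⟨_, ⟨y, hy, rfl⟩, h⟩ := exists_lt_of_lt_csSup
      (⟨_, 0, hzero x hx, rfl⟩ : (φ '' P x).Nonempty) (sub_lt_self (F x) hδ)
    exact ⟨y, hy.1, hy.2.1, hy.2.2, by rw [hψF x hx]; linarith⟩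

/-- A positive functional splits over a disjoint sequence of positive vectors. -/
theorem exists_disjoint_parts {φ : StrongDual ℝ X} (hφ : 0 ≤ φ) {u : ℕ → X} (hu : ∀ k, 0 ≤ u k)
    (hd : ∀ k l, k ≠ l → u k ⊓ u l = 0) :
    ∃ ψ : ℕ → StrongDual ℝ X, (∀ k, 0 ≤ ψ k) ∧ (∀ k, φ (u k) ≤ ψ k (u k)) ∧
      ∀ N, ∑ k ∈ Finset.range N, ψ k ≤ φ := by
  choose ψ hψ hψu hψs using fun k => exists_principal_part hφ (hu k)
  refine ⟨ψ, hψ, hψu, fun N x hx => ?_⟩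
  rw [sum_apply]
  refine le_of_forall_pos_le_add fun ε hε => ?_
  have hδ : 0 < ε / (N + 1) := by positivity
  -- The near-maximisers `y k` lie below multiples of the disjoint `u k`, so they are disjoint and
  -- sum to at most `x`.
  choose y hy hyx hym hyψ using fun k => hψs k x hx _ hδ
  have hdy : ∀ k l, k ≠ l → y k ⊓ y l = 0 := by
    intro k l hkl
    obtain ⟨m, hm⟩ := hym k
    obtain ⟨n, hn⟩ := hym l
    refine le_antisymm ((inf_le_inf hm hn).trans_eq ?_) (le_inf (hy k) (hy l))
    refine inf_nsmul_eq_zero (nsmul_nonneg (hu k) m) (hu l) ?_ n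
    rw [inf_comm]
    exact inf_nsmul_eq_zero (hu l) (hu k) (hd l k hkl.symm) m
  calc ∑ k ∈ Finset.range N, ψ k x
      ≤ ∑ k ∈ Finset.range N, (φ (y k) + ε / (N + 1)) :=
        Finset.sum_le_sum fun k _ => (hyψ k).le
    _ = φ (∑ k ∈ Finset.range N, y k) + N * (ε / (N + 1)) := by
        rw [Finset.sum_add_distrib, map_sum]
        simp
    _ ≤ φ x + ε := by
        refine add_le_add (apply_mono hφ (sum_le_of_pairwise_inf_eq_zero hx hy hyx hdy N)) ?_
        rw [mul_div_assoc', div_le_iff₀ (by positivity)]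
        nlinarith

end Components

/-! ### The canonical copy is an ideal of the bidual -/

section Bidual

open NormedSpace

theorem isClosedEmbedding_inclusion (X : Type*) [NormedAddCommGroup X] [NormedSpace ℝ X]
    [CompleteSpace X] :
    Topology.IsClosedEmbedding (inclusionInDoubleDual ℝ X) :=
  Isometry.isClosedEmbedding (α := X) (γ := StrongDual ℝ (StrongDual ℝ X))
    (inclusionInDoubleDualLi ℝ (E := X)).isometry

variable {X : Type*} [NormedAddCommGroup X] [NormedSpace ℝ X] [Lattice X] [IsOrderedAddMonoid X]
  [HasSolidNorm X]

theorem inclusion_abs_le (x : X) :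
    |inclusionInDoubleDual ℝ X x| ≤ inclusionInDoubleDual ℝ X |x| :=
  abs_le'.2 ⟨fun f hf => apply_mono hf (le_abs_self x), fun f hf => by
    change -(f x) ≤ f |x|
    rw [← map_neg]
    exact apply_mono hf (neg_le_abs x)⟩

variable [IsOrderedModule ℝ X]

/-- The order interval `[0, x]` is weak* dense in the order interval `[0, x]` of the bidual. -/
theorem exists_mem_Icc_abs_sub_le {x : X} (hx : 0 ≤ x) {φ : StrongDual ℝ (StrongDual ℝ X)}
    (hφ : 0 ≤ φ) (hφx : φ ≤ inclusionInDoubleDual ℝ X x) (F : Finset (StrongDual ℝ X)) {ε : ℝ}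
    (hε : 0 < ε) : ∃ y, 0 ≤ y ∧ y ≤ x ∧ ∀ f ∈ F, |f y - φ f| ≤ ε := by
  classical
  let L : X →L[ℝ] (F → ℝ) := ContinuousLinearMap.pi fun f => f.1
  let p : F → ℝ := fun f => φ f.1
  have hconv : Convex ℝ (closure (L '' (Set.Icc 0 x))) :=
    ((convex_Icc 0 x).linear_image L.toLinearMap).closure
  by_cases hp : p ∈ closure (L '' (Set.Icc 0 x))
  · obtain ⟨_, ⟨y, hy, rfl⟩, hd⟩ := Metric.mem_closure_iff.1 hp ε hε
    refine ⟨y, hy.1, hy.2, fun f hf => ?_⟩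
    have h1 := (dist_le_pi_dist p (L y) ⟨f, hf⟩).trans hd.le
    rwa [dist_comm, Real.dist_eq] at h1
  · exfalso
    -- `Λ` comes from a combination `f₀` of members of `F`. By Riesz-Kantorovich `c` bounds `f₀⁺ x`,
    -- and `f₀⁺ x ≥ φ f₀⁺ ≥ φ f₀ = Λ p > c`.
    obtain ⟨Λ, c, hΛ, hc⟩ := geometric_hahn_banach_closed_point hconv isClosed_closure hp
    let f₀ : StrongDual ℝ X := Λ.comp L
    have hrep : ∀ v : F → ℝ, Λ v = ∑ i, v i * Λ (fun j => if i = j then 1 else 0) := fun v => by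
      simpa using LinearMap.pi_apply_eq_sum_univ Λ.toLinearMap v
    have hf₀ : f₀ = ∑ i : F, Λ (fun j => if i = j then 1 else 0) • i.1 := by
      ext y
      rw [sum_apply]
      refine (hrep (L y)).trans (Finset.sum_congr rfl fun i _ => ?_)
      exact mul_comm _ _
    have hφf : φ f₀ = Λ p := by
      rw [hf₀, map_sum, hrep p]
      refine Finset.sum_congr rfl fun i _ => ?_
      rw [map_smul, smul_eq_mul, mul_comm]
    have h1 : φ f₀ ≤ φ (dualPos f₀) := apply_mono hφ (le_dualPos f₀)
    have h2 : φ (dualPos f₀) ≤ dualPos f₀ x := hφx _ (dualPos_nonneg f₀)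
    have h3 : dualPos f₀ x ≤ c := by
      rw [dualPos_of_nonneg _ hx]
      exact coneSup_le _ hx fun y hy hyx =>
        (hΛ _ (subset_closure ⟨y, ⟨hy, hyx⟩, rfl⟩)).le
    linarith

/-- Heuristically `y² = sup_t (2ty - t²x)` when `x` is the unit. Among the `y` weak* close to `φ`,
two with almost minimal `g (y²)` must be close, since their midpoint has a smaller square by the
parallelogram law. -/
theorem exists_mem_Icc_norm_sub_le {x : X} (hx : 0 ≤ x) {φ : StrongDual ℝ (StrongDual ℝ X)}
    (hφ : 0 ≤ φ) (hφx : φ ≤ inclusionInDoubleDual ℝ X x) {ε : ℝ} (hε : 0 < ε)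
    {g : StrongDual ℝ X} (hg : 0 ≤ g) (hgε : ∀ w, 0 ≤ w → w ≤ x → ‖w‖ ≤ g w + ε) :
    ∃ y, 0 ≤ y ∧ y ≤ x ∧ ‖φ - inclusionInDoubleDual ℝ X y‖ ≤ 4 * ε := by
  classical
  -- `w` runs through the upper bounds of the "square" of `y` in the algebra with unit `x`
  let A : Finset (StrongDual ℝ X) → Set ℝ := fun F => {r | ∃ y w, 0 ≤ y ∧ y ≤ x ∧
    (∀ f ∈ F, |f y - φ f| ≤ ε) ∧ (∀ t : ℝ, (2 * t) • y - t ^ 2 • x ≤ w) ∧ g w = r}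
  have hgx : 0 ≤ g x := apply_nonneg hg hx
  have hA0 : ∀ F, BddBelow (A F) := by
    refine fun F => ⟨0, ?_⟩
    rintro _ ⟨y, w, -, -, -, hw, rfl⟩
    exact apply_nonneg hg (by simpa using hw 0)
  have hAx : ∀ F, g x ∈ A F := by
    intro F
    obtain ⟨y, hy, hyx, hyF⟩ := exists_mem_Icc_abs_sub_le hx hφ hφx F hε
    refine ⟨y, x, hy, hyx, hyF, fun t => ?_, rfl⟩
    rcases le_total 0 t with ht | ht
    · have h1 : (2 * t) • y ≤ (2 * t) • x := smul_le_smul_of_nonneg_left hyx (by positivity)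
      have h2 : 0 ≤ (1 - t) ^ 2 • x := smul_nonneg (sq_nonneg _) hx
      rw [← sub_nonneg] at h1 ⊢
      have e : x - ((2 * t) • y - t ^ 2 • x) = ((2 * t) • x - (2 * t) • y) + (1 - t) ^ 2 • x := by
        module
      rw [e]
      exact add_nonneg h1 h2
    · have h1 : 0 ≤ (-(2 * t)) • y := smul_nonneg (by linarith) hy
      have h2 : 0 ≤ (1 + t ^ 2) • x := smul_nonneg (by positivity) hx
      rw [← sub_nonneg]
      have e : x - ((2 * t) • y - t ^ 2 • x) = (-(2 * t)) • y + (1 + t ^ 2) • x := by module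
      rw [e]
      exact add_nonneg h1 h2
  have hmono : ∀ F F', F ⊆ F' → A F' ⊆ A F := by
    rintro F F' h r ⟨y, w, h1, h2, h3, h4⟩
    exact ⟨y, w, h1, h2, fun f hf => h3 f (h hf), h4⟩
  have hbdd : BddAbove (Set.range fun F => sInf (A F)) := by
    refine ⟨g x, ?_⟩
    rintro _ ⟨F, rfl⟩
    exact csInf_le (hA0 F) (hAx F)
  -- Every infimum is at most `d`, and that of `F₀` exceeds `d - η`. With `2η = tε` and `t * g x ≤
  -- ε`, the midpoint estimate gives `g |y - z| ≤ 2ε`.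
  set d := ⨆ F, sInf (A F)
  have ht : 0 < ε / (1 + g x) := by positivity
  set t := ε / (1 + g x) with htdef
  have htg : t * g x ≤ ε := by
    rw [htdef, div_mul_eq_mul_div, div_le_iff₀ (by positivity)]
    nlinarith
  have hη : 0 < t * ε / 2 := by positivity
  set η := t * ε / 2 with hηdef
  obtain ⟨F₀, hF₀⟩ := exists_lt_of_lt_ciSup (sub_lt_self d hη)
  have hpick : ∀ F, ∃ r ∈ A F, r < d + η := fun F =>
    exists_lt_of_csInf_lt ⟨_, hAx F⟩ ((le_ciSup hbdd F).trans_lt (lt_add_of_pos_right d hη))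
  obtain ⟨_, ⟨y, w, hy, hyx, hyF, hw, rfl⟩, hwd⟩ := hpick F₀
  refine ⟨y, hy, hyx, ContinuousLinearMap.opNorm_le_of_unit_norm (by positivity) fun f hf => ?_⟩
  -- `y` was fixed before `f`; only `z` depends on `f`. This makes the bound uniform over unit
  -- functionals.
  obtain ⟨_, ⟨z, w', hz, hzx, hzF, hw', rfl⟩, hwd'⟩ := hpick (insert f F₀)
  have habs : |y - z| ≤ x := abs_le'.2 ⟨(sub_le_self y hz).trans hyx, by
    rw [neg_sub]; exact (sub_le_self z hy).trans hzx⟩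
  -- The subtracted term bounds `(|y - z| / 2)²` from below by `t|y - z| - t²x`.
  have hmid : (1 / 2 : ℝ) * (g w + g w') - (t * g |y - z| - t ^ 2 * g x) ∈ A F₀ := by
    refine ⟨(1 / 2 : ℝ) • (y + z), (1 / 2 : ℝ) • (w + w') - (t • |y - z| - t ^ 2 • x),
      smul_nonneg (by norm_num) (add_nonneg hy hz), ?_, fun h hh => ?_, fun s => ?_, ?_⟩
    · have := smul_le_smul_of_nonneg_left (add_le_add hyx hzx) (by norm_num : (0 : ℝ) ≤ 1 / 2)
      refine this.trans_eq ?_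
      module
    · have h1 := hyF h hh
      have h2 := hzF h (Finset.mem_insert_of_mem hh)
      rw [map_smul, map_add, smul_eq_mul]
      rw [abs_le] at h1 h2 ⊢
      constructor <;> linarith
    · have hpm : |y - z| ≤ t⁻¹ •
          ((1 / 2 : ℝ) • (w + w') - s • (y + z) + (s ^ 2 + t ^ 2) • x) := by
        refine abs_le'.2 ⟨?_, ?_⟩ <;> rw [le_inv_smul_iff_of_pos ht, ← sub_nonneg]
        · have h := smul_nonneg (by norm_num : (0 : ℝ) ≤ 1 / 2)
            (add_nonneg (sub_nonneg.2 (hw (s + t))) (sub_nonneg.2 (hw' (s - t))))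
          refine h.trans_eq ?_
          module
        · have h := smul_nonneg (by norm_num : (0 : ℝ) ≤ 1 / 2)
            (add_nonneg (sub_nonneg.2 (hw (s - t))) (sub_nonneg.2 (hw' (s + t))))
          refine h.trans_eq ?_
          module
      rw [le_inv_smul_iff_of_pos ht, ← sub_nonneg] at hpm
      rw [← sub_nonneg]
      refine hpm.trans_eq ?_
      module
    · simp only [map_sub, map_smul, map_add, smul_eq_mul]
  have h1 := csInf_le (hA0 F₀) hmid
  have h2 : t * g |y - z| ≤ t * (2 * ε) := by nlinarith
  have h3 : g |y - z| ≤ 2 * ε := le_of_mul_le_mul_left h2 ht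
  have h4 : ‖y - z‖ ≤ 3 * ε := by
    rw [← norm_abs_eq_norm]
    linarith [hgε _ (abs_nonneg (y - z)) habs]
  have h5 : |f (y - z)| ≤ 3 * ε := by
    have := f.le_opNorm (y - z)
    rw [hf, one_mul] at this
    exact this.trans h4
  have h6 := hzF f (Finset.mem_insert_self f F₀)
  change |φ f - f y| ≤ 4 * ε
  rw [map_sub] at h5
  rw [abs_le] at h5 h6 ⊢
  constructor <;> linarith

/-- The isometric copy of `[0, x]` is norm closed, so approximation suffices. -/
theorem PositiveSchurProperty.exists_eq_of_le [CompleteSpace X] (hX : PositiveSchurProperty X)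
    {x : X} (hx : 0 ≤ x) {φ : StrongDual ℝ (StrongDual ℝ X)}
    (hφ : 0 ≤ φ) (hφx : φ ≤ inclusionInDoubleDual ℝ X x) :
    ∃ y, 0 ≤ y ∧ y ≤ x ∧ inclusionInDoubleDual ℝ X y = φ := by
  have hcl : IsClosed (inclusionInDoubleDual ℝ X '' (Set.Icc 0 x) :
      Set (StrongDual ℝ (StrongDual ℝ X))) :=
    (isClosedEmbedding_inclusion X).isClosedMap _ isClosed_Icc
  have hmem : φ ∈ closure (inclusionInDoubleDual ℝ X '' (Set.Icc 0 x) :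
      Set (StrongDual ℝ (StrongDual ℝ X))) := by
    refine (Metric.mem_closure_iff (α := StrongDual ℝ (StrongDual ℝ X))).2 fun ε hε => ?_
    obtain ⟨g, hg, hgε⟩ := hX.exists_norm_le_apply_add x (ε := ε / 5) (by positivity)
    obtain ⟨y, hy, hyx, h⟩ := exists_mem_Icc_norm_sub_le hx hφ hφx (ε := ε / 5) (by positivity) hg hgε
    refine ⟨_, ⟨y, ⟨hy, hyx⟩, rfl⟩, ?_⟩
    exact (dist_eq_norm φ (inclusionInDoubleDual ℝ X y)).trans_lt (h.trans_lt (by linarith))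
  rw [hcl.closure_eq] at hmem
  obtain ⟨y, hy, rfl⟩ := hmem
  exact ⟨y, hy.1, hy.2, rfl⟩

theorem PositiveSchurProperty.isClosedIdeal_canonicalImage [CompleteSpace X]
    (hX : PositiveSchurProperty X) :
    IsClosedIdeal (StrongDual ℝ (StrongDual ℝ X)) (canonicalImage X) := by
  refine ⟨(isClosedEmbedding_inclusion X).isClosed_range, ?_⟩
  · rintro _ ⟨x, rfl⟩ φ hφ
    have hle : |φ| ≤ inclusionInDoubleDual ℝ X |x| := hφ.trans (inclusion_abs_le x)
    obtain ⟨a, -, -, ha⟩ := hX.exists_eq_of_le (abs_nonneg x) (posPart_nonneg φ)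
      (le_trans (by rw [← posPart_add_negPart φ]; exact le_add_of_nonneg_right (negPart_nonneg φ))
        hle)
    obtain ⟨b, -, -, hb⟩ := hX.exists_eq_of_le (abs_nonneg x) (negPart_nonneg φ)
      (le_trans (by rw [← posPart_add_negPart φ]; exact le_add_of_nonneg_left (posPart_nonneg φ))
        hle)
    refine ⟨a - b, ?_⟩
    change inclusionInDoubleDual ℝ X (a - b) = φ
    rw [map_sub, ha, hb, posPart_sub_negPart]

end Bidual

/-! ### Copies of `ℓ¹` and the distance from the space -/

section Copies

open NormedSpace

/-- Since `a = b ⊓ a`, nonexpansiveness of the meet bounds `a - a ⊓ |c|` by `b - c`. -/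
theorem norm_le_norm_sub_add_norm_inf_abs {X : Type*} [NormedAddCommGroup X] [Lattice X]
    [IsOrderedAddMonoid X] [HasSolidNorm X] {a b : X} (ha : 0 ≤ a) (hab : a ≤ b) (c : X) :
    ‖a‖ ≤ ‖b - c‖ + ‖a ⊓ |c|‖ := by
  have h1 : ‖a - a ⊓ |c|‖ ≤ ‖b - c‖ := by
    have h2 := norm_inf_sub_inf_le_norm b |c| a
    rw [inf_comm b, inf_eq_left.2 hab, inf_comm |c|] at h2
    have h3 := norm_abs_sub_abs b c
    rw [abs_of_nonneg (ha.trans hab)] at h3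
    exact h2.trans h3
  calc ‖a‖ = ‖(a - a ⊓ |c|) + a ⊓ |c|‖ := by rw [sub_add_cancel]
    _ ≤ ‖a - a ⊓ |c|‖ + ‖a ⊓ |c|‖ := norm_add_le _ _
    _ ≤ ‖b - c‖ + ‖a ⊓ |c|‖ := add_le_add h1 le_rfl

variable {X : Type*} [NormedAddCommGroup X] [NormedSpace ℝ X] [Lattice X] [IsOrderedAddMonoid X]
  [HasSolidNorm X]

theorem ellOne_summable (a : ellOne) : Summable fun n => |a n| := by
  simpa using (lp.memℓp a).summable (by simp)

theorem ellOne_tsum_le_norm (a : ellOne) : ∑' n, a n ≤ ‖a‖ := by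
  rw [lp.norm_eq_tsum_rpow (by simp)]
  simp only [ENNReal.toReal_one, Real.rpow_one, Real.norm_eq_abs, div_one]
  exact Summable.tsum_le_tsum (fun n => le_abs_self _) (ellOne_summable a).of_abs
    (ellOne_summable a)

/-- The image of the unit vectors under a lattice embedding of `ℓ¹` is a disjoint bounded
sequence on which some positive functional is at least `1`. -/
theorem ContainsLatticeCopy.exists_disjoint_seq (h : ContainsLatticeCopy ellOne X) :
    ∃ (u : ℕ → X) (φ : StrongDual ℝ X) (M : ℝ), 0 < M ∧ (∀ k, 0 ≤ u k) ∧ (∀ k, ‖u k‖ ≤ M) ∧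
      (∀ k l, k ≠ l → u k ⊓ u l = 0) ∧ 0 ≤ φ ∧ ∀ k, 1 ≤ φ (u k) := by
  obtain ⟨T, hsup, hinf, c, hc, hT⟩ := h
  let e : ℕ → ellOne := fun k => lp.single 1 k (1 : ℝ)
  have he : ∀ k n, e k n = if n = k then 1 else 0 := fun k n => by
    simp only [e, lp.single_apply, Pi.single_apply]
  have he0 : ∀ k, 0 ≤ e k := fun k n => by
    rw [he]; change (0 : ℝ) ≤ _; split_ifs <;> norm_num
  have hT0 : ∀ a : ellOne, 0 ≤ a → 0 ≤ T a := fun a ha => by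
    have := hsup a 0
    rw [sup_eq_left.2 ha, map_zero] at this
    rw [this]
    exact le_sup_right
  -- Vectors of `C` have norm at least `1`, so `T '' C` misses the ball of radius `c`. A separating
  -- functional is at least `r > 0` on every `T (e k)`.
  let C : Set ellOne := {a | 1 ≤ ∑' n, a n}
  have hC : Convex ℝ C := by
    intro a ha b hb s t hs ht hst
    have ha' := (ellOne_summable a).of_abs
    have hb' := (ellOne_summable b).of_abs
    change 1 ≤ ∑' n, (s * a n + t * b n)
    rw [(ha'.mul_left s).tsum_add (hb'.mul_left t), tsum_mul_left, tsum_mul_left]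
    change 1 ≤ ∑' n, a n at ha
    change 1 ≤ ∑' n, b n at hb
    nlinarith
  have hdisj : Disjoint (Metric.ball (0 : X) c) (T '' C) := by
    refine Set.disjoint_left.2 ?_
    rintro _ hx ⟨a, ha, rfl⟩
    rw [mem_ball_zero_iff] at hx
    have h1 : 1 ≤ ‖a‖ := le_trans ha (ellOne_tsum_le_norm a)
    nlinarith [hT a]
  obtain ⟨f, r, hf, hr⟩ := geometric_hahn_banach_open (convex_ball (0 : X) c) Metric.isOpen_ball
    (hC.linear_image T.toLinearMap) hdisj
  have hr0 : 0 < r := by simpa using hf 0 (Metric.mem_ball_self hc)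
  have heC : ∀ k, e k ∈ C := fun k => by
    change 1 ≤ ∑' n, e k n
    simp [he]
  refine ⟨fun k => T (e k), r⁻¹ • |f|, ‖T‖ + 1, by positivity, fun k => hT0 _ (he0 k),
    fun k => ?_, fun k l hkl => ?_, smul_nonneg (by positivity) (abs_nonneg f), fun k => ?_⟩
  · have h1 := T.le_opNorm (e k)
    have h2 : ‖e k‖ = 1 := by simp [e, lp.norm_single]
    rw [h2] at h1
    linarith
  · change T (e k) ⊓ T (e l) = 0
    rw [← hinf, ← map_zero T]
    congr 1
    refine lp.ext (funext fun n => ?_)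
    change min (e k n) (e l n) = 0
    rw [he, he]
    split_ifs <;> first | omega | simp
  · have h1 : r ≤ f (T (e k)) := hr _ ⟨e k, heC k, rfl⟩
    have h2 : f (T (e k)) ≤ |f| (T (e k)) := le_abs_self f _ (hT0 _ (he0 k))
    change 1 ≤ r⁻¹ * |f| (T (e k))
    rw [inv_mul_eq_div, one_le_div hr0]
    exact h1.trans h2

/-- A sequence of positive functionals with order bounded partial sums can be summed over
subsets, and the sums over disjoint sets still have bounded partial sums. -/
theorem exists_functional_tsum {φ : StrongDual ℝ X} {ψ : ℕ → StrongDual ℝ X} (hψ : ∀ k, 0 ≤ ψ k)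
    (hφ : ∀ N, ∑ k ∈ Finset.range N, ψ k ≤ φ) :
    ∃ Ψ : ℕ → StrongDual ℝ X, (∀ n j, ψ (Nat.pair n j) ≤ Ψ n) ∧
      ∀ N, ∑ n ∈ Finset.range N, Ψ n ≤ φ := by
  have hle : ∀ x, 0 ≤ x → ∀ N, ∑ k ∈ Finset.range N, ψ k x ≤ φ x := fun x hx N => by
    have := hφ N x hx
    rwa [sum_apply] at this
  have hsum : ∀ x, 0 ≤ x → Summable fun k => ψ k x := fun x hx =>
    summable_of_sum_range_le (fun k => apply_nonneg (hψ k) hx) (hle x hx)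
  have htsum : ∀ x, 0 ≤ x → ∑' k, ψ k x ≤ φ x := fun x hx =>
    Real.tsum_le_of_sum_range_le (fun k => apply_nonneg (hψ k) hx) (hle x hx)
  have hinj : ∀ n, Function.Injective fun j => Nat.pair n j := fun n i j hij =>
    (Nat.pair_eq_pair.1 hij).2
  have hsub : ∀ n x, 0 ≤ x → Summable fun j => ψ (Nat.pair n j) x := fun n x hx =>
    (hsum x hx).comp_injective (hinj n)
  have hprod : ∀ x, 0 ≤ x → Summable fun p : ℕ × ℕ => ψ (Nat.pair p.1 p.2) x := fun x hx =>
    (hsum x hx).comp_injective Nat.pairEquiv.injective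
  have hdouble : ∀ x, 0 ≤ x → ∑' n, ∑' j, ψ (Nat.pair n j) x = ∑' k, ψ k x := fun x hx => by
    rw [← (hprod x hx).tsum_prod]
    exact Nat.pairEquiv.tsum_eq fun k => ψ k x
  have houter : ∀ x, 0 ≤ x → Summable fun n => ∑' j, ψ (Nat.pair n j) x := fun x hx =>
    (hprod x hx).prod
  have hin0 : ∀ n x, 0 ≤ x → 0 ≤ ∑' j, ψ (Nat.pair n j) x := fun n x hx =>
    tsum_nonneg fun j => apply_nonneg (hψ _) hx
  have hNle : ∀ N x, 0 ≤ x → ∑ n ∈ Finset.range N, ∑' j, ψ (Nat.pair n j) x ≤ φ x :=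
    fun N x hx => ((houter x hx).sum_le_tsum _ fun n _ => hin0 n x hx).trans
      ((hdouble x hx).trans_le (htsum x hx))
  have hex : ∀ n, ∃ Ψ : StrongDual ℝ X, 0 ≤ Ψ ∧ ∀ x, 0 ≤ x →
      Ψ x = ∑' j, ψ (Nat.pair n j) x := fun n => by
    refine exists_functional_of_cone _ (fun a b ha hb => ?_) (hin0 n) ‖φ‖ fun a ha => ?_
    · simp only [map_add]
      exact (hsub n a ha).tsum_add (hsub n b hb)
    · refine le_trans ?_ ((hNle (n + 1) a ha).trans ((le_abs_self _).trans (φ.le_opNorm a)))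
      exact Finset.single_le_sum (f := fun n => ∑' j, ψ (Nat.pair n j) a)
        (fun m _ => hin0 m a ha) (Finset.self_mem_range_succ n)
  choose Ψ hΨ0 hΨ using hex
  refine ⟨Ψ, fun n j x hx => ?_, fun N x hx => ?_⟩
  · rw [hΨ n x hx]
    exact (hsub n x hx).le_tsum j fun i _ => apply_nonneg (hψ _) hx
  · rw [sum_apply, Finset.sum_congr rfl fun n _ => hΨ n x hx]
    exact hNle N x hx

/-- A positive sequence with order bounded partial sums that stays away from a subspace refutes
the positive Schur property of the quotient. -/
theorem not_positiveSchurProperty_quotient {I : Submodule ℝ X} {x : ℕ → X} {b : X}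
    (hx : ∀ n, 0 ≤ x n) (hb : ∀ N, ∑ n ∈ Finset.range N, x n ≤ b) {δ : ℝ} (hδ : 0 < δ)
    (hI : ∀ n, ∀ y ∈ I, δ ≤ ‖x n - y‖) : ¬ PositiveSchurProperty (LatticeQuotient X I) := by
  intro h
  let q : X →L[ℝ] LatticeQuotient X I := I.mkQL
  have hw : ∀ f : StrongDual ℝ X, Tendsto (fun n => f (x n)) atTop (𝓝 0) := fun f =>
    tendsto_apply_zero_of_sum_le hx (fun f hf => ⟨f b, fun N => by
      rw [← map_sum]; exact apply_mono hf (hb N)⟩) f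
  have hlim := tendsto_norm_zero.comp (h (fun n => q (x n))
    (fun n => ⟨0, x n, map_zero _, rfl, hx n⟩)
    (tendsto_toWeakSpace_zero fun f => hw (f.comp q)))
  refine absurd (ge_of_tendsto' hlim (b := δ) fun n => ?_) (not_le.2 hδ)
  refine le_of_forall_pos_lt_add fun ε hε => ?_
  obtain ⟨m, hm, hlt⟩ := Submodule.Quotient.norm_mk_lt (S := I) (I.mkQ (x n)) hε
  have hy : x n - m ∈ I := (Submodule.Quotient.eq _).1 hm.symm
  refine (hI n _ hy).trans_lt ?_
  rw [sub_sub_cancel]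
  exact hlt

theorem not_positiveSchurProperty {x : ℕ → X} {b : X}
    (hx : ∀ n, 0 ≤ x n) (hb : ∀ N, ∑ n ∈ Finset.range N, x n ≤ b) {δ : ℝ} (hδ : 0 < δ)
    (hI : ∀ n, δ ≤ ‖x n‖) : ¬ PositiveSchurProperty X := fun h => by
  have hlim := tendsto_norm_zero.comp (h x hx (tendsto_weak_zero_of_sum_le hx
    fun f hf => ⟨f b, fun N => by rw [← map_sum]; exact apply_mono hf (hb N)⟩))
  exact absurd (ge_of_tendsto' hlim hI) (not_le.2 hδ)

variable [IsOrderedModule ℝ X] [CompleteSpace X]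

/-- A positive element of the bidual that dominates a uniformly positive sequence with order
bounded partial sums stays away from the space. -/
theorem PositiveSchurProperty.le_norm_sub (hX : PositiveSchurProperty X)
    {φ Ψ : StrongDual ℝ (StrongDual ℝ X)} {ψ : ℕ → StrongDual ℝ (StrongDual ℝ X)}
    (hψ : ∀ k, 0 ≤ ψ k) (hψΨ : ∀ k, ψ k ≤ Ψ) (hφ : ∀ N, ∑ k ∈ Finset.range N, ψ k ≤ φ)
    {δ : ℝ} (hδ : ∀ k, δ ≤ ‖ψ k‖) (y : X) : δ ≤ ‖Ψ - inclusionInDoubleDual ℝ X y‖ := by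
  set y' := inclusionInDoubleDual ℝ X y
  -- The meets lie below `|y|`, hence belong to the ideal `X`, where the positive Schur property
  -- applies.
  have hz : ∀ k, ∃ z, 0 ≤ z ∧ z ≤ |y| ∧ inclusionInDoubleDual ℝ X z = ψ k ⊓ |y'| := fun k =>
    hX.exists_eq_of_le (abs_nonneg y) (le_inf (hψ k) (abs_nonneg y'))
      (inf_le_right.trans (inclusion_abs_le y))
  choose z hz0 _ hzψ using hz
  have hlim := hX z hz0 (tendsto_weak_zero_of_sum_le hz0 fun f hf => ⟨φ f, fun N => by
    have h1 := hφ N f hf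
    rw [sum_apply] at h1
    refine le_trans (Finset.sum_le_sum fun k _ => ?_) h1
    have h2 : inclusionInDoubleDual ℝ X (z k) f ≤ ψ k f := by
      rw [hzψ]; exact (inf_le_left : ψ k ⊓ |y'| ≤ ψ k) f hf
    exact h2⟩)
  have hbound : ∀ k, δ ≤ ‖Ψ - y'‖ + ‖z k‖ := by
    intro k
    have h2 : ‖ψ k ⊓ |y'|‖ = ‖z k‖ := by
      rw [← hzψ]
      exact (inclusionInDoubleDualLi ℝ (E := X)).norm_map (z k)
    rw [← h2]
    exact (hδ k).trans (norm_le_norm_sub_add_norm_inf_abs (hψ k) (hψΨ k) y')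
  have h := (tendsto_norm_zero.comp hlim).const_add ‖Ψ - y'‖
  rw [add_zero] at h
  exact ge_of_tendsto' h hbound

end Copies

end BanachLat

theorem proposition2p7 (E : Type*) [NormedAddCommGroup E] [NormedSpace ℝ E] [CompleteSpace E]
    [Lattice E] [IsOrderedAddMonoid E] [IsOrderedModule ℝ E] [HasSolidNorm E]
    (hE : BanachLat.PositiveSchurProperty E)
    (hcopy : BanachLat.ContainsLatticeCopy BanachLat.ellOne (StrongDual ℝ E)) :
    BanachLat.IsClosedIdeal (StrongDual ℝ (StrongDual ℝ E)) (BanachLat.canonicalImage E) ∧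
      ¬ BanachLat.PositiveSchurProperty (StrongDual ℝ (StrongDual ℝ E)) ∧
      ¬ BanachLat.PositiveSchurProperty (BanachLat.LatticeQuotient
        (StrongDual ℝ (StrongDual ℝ E)) (BanachLat.canonicalImage E)) := by
  open BanachLat in
  obtain ⟨u, φ, M, hM, hu, huM, hd, hφ, hφu⟩ := hcopy.exists_disjoint_seq
  obtain ⟨ψ, hψ, hψu, hψφ⟩ := exists_disjoint_parts hφ hu hd
  -- A lower norm bound alone does not keep a single `ψ k` away from `E`; dominating an infinite
  -- block of them does.
  obtain ⟨Ψ, hψΨ, hΨφ⟩ := exists_functional_tsum hψ hψφ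
  have hψM : ∀ k, 1 / M ≤ ‖ψ k‖ := fun k => by
    rw [div_le_iff₀ hM]
    calc 1 ≤ ψ k (u k) := (hφu k).trans (hψu k)
      _ ≤ ‖ψ k‖ * ‖u k‖ := (le_abs_self _).trans ((ψ k).le_opNorm _)
      _ ≤ ‖ψ k‖ * M := mul_le_mul_of_nonneg_left (huM k) (norm_nonneg _)
  have hΨ0 : ∀ n, 0 ≤ Ψ n := fun n => (hψ _).trans (hψΨ n 0)
  have hdist : ∀ n y, 1 / M ≤ ‖Ψ n - NormedSpace.inclusionInDoubleDual ℝ E y‖ := fun n y =>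
    hE.le_norm_sub (fun j => hψ (Nat.pair n j)) (hψΨ n)
      (sum_le_of_injective hψ hψφ fun i j hij => (Nat.pair_eq_pair.1 hij).2)
      (fun j => hψM _) y
  have hδ : 0 < 1 / M := by positivity
  refine ⟨hE.isClosedIdeal_canonicalImage,
    not_positiveSchurProperty hΨ0 hΨφ hδ fun n => by simpa using hdist n 0,
    not_positiveSchurProperty_quotient hΨ0 hΨφ hδ ?_⟩
  rintro n _ ⟨y, rfl⟩
  exact hdist n y
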